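/- Let $\mathbb{k}$ be a commutative unital ring, $A$ an associative unital $\mathbb{k}$-algebra, and $(\Omega_d^\bullet,\wedge,d)$ an exterior algebra over $A$, i.e. an $\mathbb{N}$-graded differential graded $\mathbb{k}$-algebra with $\Omega_d^0=A$ that is generated as an algebra by $A$ and $dA$. For a left $A$-module $E$ write $\Omega_d^mE=\Omega_d^m\otimes_AE$ and $J_d^1E=J_d^1A\otimes_AE$, where $J_d^1A=(A\otimes_{\mathbb{k}}A)/N_d$ and $N_d=\{\sum a_i\otimes b_i:\ \sum a_ib_i=0,\ \sum a_i\,db_i=0\}$, with its evident $A$-bimodule structure. Let $(\Omega_d^1\ltimes\Omega_d^2)E$ be $\Omega_d^1E\oplus\Omega_d^2E$ with the left $A$-action $\lambda(\alpha+\beta)=\lambda\alpha+(d\lambda\wedge\alpha+\lambda\beta)$, and let $$\widetilde{\mathfrak D}_E=(\widetilde{\mathfrak D}^{I}_E,\widetilde{\mathfrak D}^{II}_E):J_d^1J_d^1E\to(\Omega_d^1\ltimes\Omega_d^2)E,$$ $$\widetilde{\mathfrak D}^{I}_E([a\otimes b]\otimes_A[c\otimes c']\otimes_A e)=a\,d(bc)\,c'\otimes_A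 e,\qquad \widetilde{\mathfrak D}^{II}_E([a\otimes b]\otimes_A[c\otimes c']\otimes_A e)=da\wedge d(bc)\,c'\otimes_A e .$$ *Holonomic jets:* $J_d^0E=E$, $J_d^1E$ is as above, $l_d^{1,0}=\mathrm{id}$, and for $n\ge 2$ the module $J_d^nE$ is the kernel of $\widetilde{\mathfrak D}_{J_d^{n-2}E}\circ J_d^1(l_d^{1,n-2})$ on $J_d^1J_d^{n-1}E$, with inclusion $l_d^{1,n-1}:J_d^nE\hookrightarrow J_d^1J_d^{n-1}E$. *Sesquiholonomic jets:* $J_d^{\{0\}}E=E$, $J_d^{\{1\}}E=J_d^1E$, $l_d^{\{1\}}=\mathrm{id}$, and for $n\ge 2$ the module $J_d^{\{n\}}E$ is the kernel of $\widetilde{\mathfrak D}^{I}_{J_d^{n-2}E}\circ J_d^1(l_d^{1,n-2})$ on $J_d^1J_d^{n-1}E$, with inclusion $l_d^{\{n\}}:J_d^{\{n\}}E\hookrightarrow J_d^1J_d^{n-1}E$. Let $t_d^{\{n\}}:J_d^nE\hookrightarrow J_d^{\{n\}}E$ be the natural inclusion (the identity for $n=0,1$) and, for $n\ge 1$, $l_d^{\{1,n-1\}}=J_d^1(t_d^{\{n-1\}})\circ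 l_d^{\{n\}}:J_d^{\{n\}}E\to J_d^1J_d^{\{n-1\}}E$. *Spencer operators:* let $\mathcal S^{1,m}_{d,E}:\Omega_d^mJ_d^1E\to\Omega_d^{m+1}E$, $\omega\otimes_A[y\otimes z]\otimes_A e\mapsto d(\omega y)z\otimes_A e$, and for $n\ge 1$, $m\ge 0$ put $$\mathcal S_d^{n,m}=\mathcal S^{1,m}_{d,J_d^{n-1}}\circ\Omega_d^m(l_d^{1,n-1}),\qquad \mathcal S_d^{\{n,m\}}=\mathcal S^{1,m}_{d,J_d^{\{n-1\}}}\circ\Omega_d^m(l_d^{\{1,n-1\}}),\qquad \overline{\mathcal S}_d^{\{n,m\}}=\mathcal S^{1,m}_{d,J_d^{n-1}}\circ\Omega_d^m(l_d^{\{n\}}),$$ where for $m=0$ one identifies $\Omega_d^0\otimes_A M$ with $M$. **Lemma 3.21.** For every $n\ge 2$ (and at every left $A$-module $E$): 1. $\mathcal S_d^{n-1,1}\circ\overline{\mathcal S}_d^{\{n,0\}}=-\widetilde{\mathfrak D}^{II}_{J_d^{n-2}}\circ J_d^1(l_d^{1,n-2})\circ l_d^{\{n\}}$ as maps $J_d^{\{n\}}\to\Omega_d^2J_d^{n-2}$;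 2. $\ker\big(\mathcal S_d^{n-1,1}\circ\overline{\mathcal S}_d^{\{n,0\}}\big)=J_d^n$, as submodules of $J_d^{\{n\}}$, where $J_d^n$ is identified with its image under $t_d^{\{n\}}$; 3. $\ker\big(\mathcal S_d^{\{n-1,1\}}\circ\mathcal S_d^{\{n,0\}}\big)\supseteq J_d^n$, with equality if $\Omega_d^2$ is flat as a right $A$-module. -/

import Mathlib

open scoped TensorProduct

universe v u

namespace NCJet

section BalancedTensor

variable (k : Type v) (A : Type u) [CommRing k] [Ring A] [Algebra k A]
variable (M : Type u) [AddCommGroup M] [Module k M] [Module A M] [IsScalarTower k A M]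
  [Module Aᵐᵒᵖ M] [SMulCommClass A Aᵐᵒᵖ M]
variable (N : Type u) [AddCommGroup N] [Module k N] [Module A N]

/-- The relations `m a ⊗ n = m ⊗ a n` inside `M ⊗[k] N`, for an `A`-bimodule `M` and a left
`A`-module `N`: their `k`-span, which is stable under the left action of `A` on `M`. -/
def balancedRel : Submodule A (M ⊗[k] N) where
  toAddSubmonoid := (Submodule.span k {t : M ⊗[k] N | ∃ (m : M) (a : A) (n : N),
    t = (MulOpposite.op a • m) ⊗ₜ[k] n - m ⊗ₜ[k] (a • n)}).toAddSubmonoid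
  smul_mem' := by
    intro c x hx
    change c • x ∈ Submodule.span k _
    change x ∈ Submodule.span k _ at hx
    induction hx using Submodule.span_induction with
    | mem x h =>
      obtain ⟨m, a, n, rfl⟩ := h
      refine Submodule.subset_span ⟨c • m, a, n, ?_⟩
      rw [smul_sub, TensorProduct.smul_tmul', TensorProduct.smul_tmul', smul_comm]
    | zero => simp
    | add x y _ _ hx hy => rw [smul_add]; exact add_mem hx hy
    | smul r x _ hx => rw [smul_comm]; exact Submodule.smul_mem _ _ hx

/-- The tensor product `M ⊗_A N` of an `A`-bimodule `M` with a left `A`-module `N`, for a possibly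
noncommutative ring `A`, as a left `A`-module. -/
def BTensor : Type u := (M ⊗[k] N) ⧸ balancedRel k A M N

instance : AddCommGroup (BTensor k A M N) :=
  inferInstanceAs (AddCommGroup ((M ⊗[k] N) ⧸ balancedRel k A M N))
instance : Module A (BTensor k A M N) :=
  inferInstanceAs (Module A ((M ⊗[k] N) ⧸ balancedRel k A M N))
instance : Module k (BTensor k A M N) :=
  inferInstanceAs (Module k ((M ⊗[k] N) ⧸ balancedRel k A M N))
instance : IsScalarTower k A (BTensor k A M N) :=
  inferInstanceAs (IsScalarTower k A ((M ⊗[k] N) ⧸ balancedRel k A M N))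

variable {k A M N}

/-- The elementary tensor `m ⊗_A n`. -/
def bt (m : M) (n : N) : BTensor k A M N := (balancedRel k A M N).mkQ (m ⊗ₜ[k] n)

theorem bt_add_left (m m' : M) (n : N) :
    (bt (m + m') n : BTensor k A M N) = bt m n + bt m' n := by
  simp only [bt, TensorProduct.add_tmul, map_add]; rfl

theorem bt_add_right (m : M) (n n' : N) :
    (bt m (n + n') : BTensor k A M N) = bt m n + bt m n' := by
  simp only [bt, TensorProduct.tmul_add, map_add]; rfl

theorem bt_smul_left (a : A) (m : M) (n : N) :
    (bt (a • m) n : BTensor k A M N) = a • bt m n := by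
  unfold bt
  rw [← TensorProduct.smul_tmul', map_smul]; rfl

theorem bt_ksmul_left (c : k) (m : M) (n : N) :
    (bt (c • m) n : BTensor k A M N) = c • bt m n := rfl

theorem bt_ksmul_right (c : k) (m : M) (n : N) :
    (bt m (c • n) : BTensor k A M N) = c • bt m n := by
  rw [← bt_ksmul_left]; unfold bt; rw [TensorProduct.smul_tmul]

theorem bt_balanced (m : M) (a : A) (n : N) :
    (bt (MulOpposite.op a • m) n : BTensor k A M N) = bt m (a • n) := by
  refine (Submodule.Quotient.eq _).2 ?_
  exact Submodule.subset_span ⟨m, a, n, rfl⟩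

@[elab_as_elim]
theorem BTensor.induction {p : BTensor k A M N → Prop} (x : BTensor k A M N)
    (tmul : ∀ m n, p (bt m n)) (add : ∀ x y, p x → p y → p (x + y)) : p x := by
  obtain ⟨t, rfl⟩ := Submodule.Quotient.mk_surjective _ x
  induction t with
  | zero => have h := tmul 0 0; simpa [bt] using h
  | tmul m n => exact tmul m n
  | add s t hs ht => exact add _ _ hs ht

/-- The `k`-linear map out of `M ⊗_A N` induced by an `A`-balanced bilinear map. -/
def BTensor.lift {P : Type u} [AddCommGroup P] [Module k P] (f : M →ₗ[k] N →ₗ[k] P)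
    (hf : ∀ m (a : A) n, f (MulOpposite.op a • m) n = f m (a • n)) :
    BTensor k A M N →ₗ[k] P :=
  (((balancedRel k A M N).restrictScalars k).liftQ (TensorProduct.lift f) (by
      intro x hx
      change x ∈ Submodule.span k _ at hx
      induction hx using Submodule.span_induction with
      | mem x h => obtain ⟨m, a, n, rfl⟩ := h; simp [hf]
      | zero => simp
      | add x y _ _ hx hy => exact add_mem hx hy
      | smul r x _ hx => exact Submodule.smul_mem _ _ hx)) ∘ₗ
    (Submodule.Quotient.restrictScalarsEquiv k (balancedRel k A M N)).symm.toLinearMap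

theorem BTensor.lift_bt {P : Type u} [AddCommGroup P] [Module k P] (f : M →ₗ[k] N →ₗ[k] P)
    (hf : ∀ m (a : A) n, f (MulOpposite.op a • m) n = f m (a • n)) (m : M) (n : N) :
    BTensor.lift f hf (bt m n) = f m n := by
  rfl

/-- The `k`-linear map `g ⊗_A id_N : M ⊗_A N → M' ⊗_A N` induced by a right `A`-linear map `g`. -/
def BTensor.mapLeft (N : Type u) [AddCommGroup N] [Module k N] [Module A N]
    {M' : Type u} [AddCommGroup M'] [Module k M'] [Module A M']
    [IsScalarTower k A M'] [Module Aᵐᵒᵖ M'] [SMulCommClass A Aᵐᵒᵖ M']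
    (g : M →ₗ[k] M') (hg : ∀ (a : A) m, g (MulOpposite.op a • m) = MulOpposite.op a • g m) :
    BTensor k A M N →ₗ[k] BTensor k A M' N :=
  BTensor.lift
    (LinearMap.mk₂ k (fun m n => bt (g m) n)
      (fun m m' n => by rw [map_add, bt_add_left])
      (fun c m n => by rw [map_smul, bt_ksmul_left])
      (fun m n n' => by rw [bt_add_right])
      (fun c m n => by rw [bt_ksmul_right]))
    (fun m a n => by
      simp only [LinearMap.mk₂_apply]
      rw [hg, bt_balanced])

/-- The left `A`-linear map `id_M ⊗_A f : M ⊗_A N → M ⊗_A N'` induced by a left `A`-linear map `f`;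
this is the action on morphisms of the functor `M ⊗_A -`. -/
def BTensor.mapRight (M : Type u) [AddCommGroup M] [Module k M] [Module A M] [IsScalarTower k A M]
    [Module Aᵐᵒᵖ M] [SMulCommClass A Aᵐᵒᵖ M]
    {N N' : Type u} [AddCommGroup N] [Module k N] [Module A N] [IsScalarTower k A N]
    [AddCommGroup N'] [Module k N'] [Module A N'] [IsScalarTower k A N'] (f : N →ₗ[A] N') :
    BTensor k A M N →ₗ[A] BTensor k A M N' :=
  let F : BTensor k A M N →ₗ[k] BTensor k A M N' := BTensor.lift
    (LinearMap.mk₂ k (fun m n => bt m (f n))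
      (fun m m' n => by rw [bt_add_left])
      (fun c m n => by rw [bt_ksmul_left])
      (fun m n n' => by rw [map_add, bt_add_right])
      (fun c m n => by rw [← LinearMap.restrictScalars_apply k f, map_smul, bt_ksmul_right]; rfl))
    (fun m a n => by
      simp only [LinearMap.mk₂_apply]
      rw [bt_balanced, map_smul])
  { toFun := F
    map_add' := F.map_add
    map_smul' := by
      intro a x
      induction x using BTensor.induction with
      | tmul m n => rw [← bt_smul_left]; exact bt_smul_left a m (f n)
      | add x y hx hy => rw [smul_add, map_add, hx, hy, map_add, smul_add] }

theorem BTensor.mapLeft_bt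
    {M' : Type u} [AddCommGroup M'] [Module k M'] [Module A M']
    [IsScalarTower k A M'] [Module Aᵐᵒᵖ M'] [SMulCommClass A Aᵐᵒᵖ M']
    (g : M →ₗ[k] M') (hg : ∀ (a : A) m, g (MulOpposite.op a • m) = MulOpposite.op a • g m)
    (m : M) (n : N) : BTensor.mapLeft N g hg (bt m n) = bt (g m) n := rfl

theorem BTensor.mapRight_bt
    {N' : Type u} [AddCommGroup N'] [Module k N'] [Module A N'] [IsScalarTower k A N]
    [IsScalarTower k A N'] (f : N →ₗ[A] N') (m : M) (n : N) :
    BTensor.mapRight (k := k) M f (bt m n) = bt m (f n) := rfl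

/-- The `k`-linear map `X ⊗_A (Y ⊗_A N) → Z ⊗_A N`, `x ⊗ (y ⊗ n) ↦ g x y ⊗ n`, induced by an
`A`-balanced bilinear map `g` of bimodules which is right `A`-linear in its second argument. -/
def BTensor.lift₂ (N : Type u) [AddCommGroup N] [Module k N] [Module A N]
    {X Y Z : Type u}
    [AddCommGroup X] [Module k X] [Module A X] [IsScalarTower k A X] [Module Aᵐᵒᵖ X]
    [SMulCommClass A Aᵐᵒᵖ X]
    [AddCommGroup Y] [Module k Y] [Module A Y] [IsScalarTower k A Y] [Module Aᵐᵒᵖ Y]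
    [SMulCommClass A Aᵐᵒᵖ Y]
    [AddCommGroup Z] [Module k Z] [Module A Z] [IsScalarTower k A Z] [Module Aᵐᵒᵖ Z]
    [SMulCommClass A Aᵐᵒᵖ Z]
    (g : X →ₗ[k] Y →ₗ[k] Z)
    (hbal : ∀ x (a : A) y, g (MulOpposite.op a • x) y = g x (a • y))
    (hlin : ∀ x (a : A) y, g x (MulOpposite.op a • y) = MulOpposite.op a • g x y) :
    BTensor k A X (BTensor k A Y N) →ₗ[k] BTensor k A Z N :=
  BTensor.lift
    { toFun := fun x => BTensor.mapLeft N (g x) (hlin x)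
      map_add' := fun x x' => by
        ext t
        induction t using BTensor.induction with
        | tmul y n =>
          simp only [LinearMap.add_apply, BTensor.mapLeft_bt, map_add, bt_add_left]
        | add s t hs ht => rw [map_add, hs, ht, map_add]
      map_smul' := fun c x => by
        ext t
        induction t using BTensor.induction with
        | tmul y n =>
          simp only [LinearMap.smul_apply, BTensor.mapLeft_bt, map_smul, bt_ksmul_left,
            RingHom.id_apply]
        | add s t hs ht => rw [map_add, hs, ht, map_add] }
    (fun x a t => by
      change BTensor.mapLeft N (g (MulOpposite.op a • x)) (hlin _) t =
        BTensor.mapLeft N (g x) (hlin x) (a • t)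
      induction t using BTensor.induction with
      | tmul y n => rw [← bt_smul_left, BTensor.mapLeft_bt, BTensor.mapLeft_bt, hbal]
      | add s t hs ht => rw [map_add, hs, ht, smul_add, map_add])

end BalancedTensor

/-- A left `A`-module over the `k`-algebra `A`, bundled with its induced `k`-module structure. -/
structure LMod (k : Type v) (A : Type u) [CommRing k] [Ring A] [Algebra k A] where
  /-- the underlying type -/
  carrier : Type u
  [addCommGroup : AddCommGroup carrier]
  [moduleBase : Module k carrier]
  [module : Module A carrier]
  [isScalarTower : IsScalarTower k A carrier]

instance (k : Type v) (A : Type u) [CommRing k] [Ring A] [Algebra k A] :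
    CoeSort (LMod k A) (Type u) := ⟨LMod.carrier⟩

attribute [instance] LMod.addCommGroup LMod.moduleBase LMod.module LMod.isScalarTower

/-- A bimodule `M` is flat as a right `A`-module: `M ⊗_A -` preserves injectivity of
maps of left `A`-modules. -/
def IsRightFlat (k : Type v) (A : Type u) [CommRing k] [Ring A] [Algebra k A]
    (M : Type u) [AddCommGroup M] [Module k M] [Module A M] [IsScalarTower k A M]
    [Module Aᵐᵒᵖ M] [SMulCommClass A Aᵐᵒᵖ M] : Prop :=
  ∀ (N N' : LMod k A) (f : N →ₗ[A] N'), Function.Injective f →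
    Function.Injective (BTensor.mapRight (k := k) M f)

/-- An exterior algebra over the `k`-algebra `A`: a differential graded `k`-algebra
`Ω = ⨁ₙ Ωⁿ` with `Ω⁰ = A` which is generated, as an algebra, by `A` and `dA`. -/
structure ExteriorCalculus (k : Type v) (A : Type u) [CommRing k] [Ring A] [Algebra k A] where
  /-- the total algebra `Ω` -/
  carrier : Type u
  [ring : Ring carrier]
  [algebra : Algebra k carrier]
  /-- the homogeneous components `Ωⁿ` -/
  grade : ℕ → Submodule k carrier
  gradedMonoid : SetLike.GradedMonoid grade
  isInternal : DirectSum.IsInternal grade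
  /-- the identification of `A` with `Ω⁰` -/
  incl : A →ₐ[k] carrier
  incl_injective : Function.Injective incl
  range_incl : LinearMap.range incl.toLinearMap = grade 0
  /-- the exterior derivative -/
  d : carrier →ₗ[k] carrier
  d_mem : ∀ (n : ℕ) (x : carrier), x ∈ grade n → d x ∈ grade (n + 1)
  d_mul : ∀ (n : ℕ) (x y : carrier), x ∈ grade n → d (x * y) = d x * y + (-1) ^ n * (x * d y)
  d_d : ∀ x : carrier, d (d x) = 0
  adjoin_eq_top :
    Algebra.adjoin k (Set.range incl ∪ Set.range (fun a => d (incl a))) = ⊤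

attribute [instance] ExteriorCalculus.ring ExteriorCalculus.algebra

namespace ExteriorCalculus

variable {k : Type v} {A : Type u} [CommRing k] [Ring A] [Algebra k A] (Ω : ExteriorCalculus k A)

theorem incl_mem (a : A) : Ω.incl a ∈ Ω.grade 0 := by
  rw [← Ω.range_incl]; exact ⟨a, rfl⟩

theorem mul_mem {p q : ℕ} {x y : Ω.carrier} (hx : x ∈ Ω.grade p) (hy : y ∈ Ω.grade q) :
    x * y ∈ Ω.grade (p + q) := by
  have := Ω.gradedMonoid
  exact SetLike.mul_mem_graded hx hy

theorem incl_mul_mem {p : ℕ} (a : A) {x : Ω.carrier} (hx : x ∈ Ω.grade p) :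
    Ω.incl a * x ∈ Ω.grade p := by
  simpa using Ω.mul_mem (Ω.incl_mem a) hx

theorem mul_incl_mem {p : ℕ} (a : A) {x : Ω.carrier} (hx : x ∈ Ω.grade p) :
    x * Ω.incl a ∈ Ω.grade p := by
  simpa using Ω.mul_mem hx (Ω.incl_mem a)

/-- The `A`-bimodule `Ωᵐ` of `m`-forms. -/
def Form (m : ℕ) : Type u := Ω.grade m

instance (m : ℕ) : AddCommGroup (Ω.Form m) := inferInstanceAs (AddCommGroup (Ω.grade m))
instance (m : ℕ) : Module k (Ω.Form m) := inferInstanceAs (Module k (Ω.grade m))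

variable {Ω} in
/-- A form as an element of the total algebra. -/
def Form.val {m : ℕ} (x : Ω.Form m) : Ω.carrier := Subtype.val x

variable {Ω} in
theorem Form.val_mem {m : ℕ} (x : Ω.Form m) : x.val ∈ Ω.grade m := Subtype.property x

variable {Ω} in
theorem Form.ext {m : ℕ} {x y : Ω.Form m} (h : x.val = y.val) : x = y := Subtype.ext h

variable {Ω} in
theorem Form.val_add {m : ℕ} (x y : Ω.Form m) : (x + y).val = x.val + y.val := rfl

variable {Ω} in
theorem Form.val_zero {m : ℕ} : (0 : Ω.Form m).val = 0 := rfl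

variable {Ω} in
theorem Form.val_smul {m : ℕ} (c : k) (x : Ω.Form m) : (c • x).val = c • x.val := rfl

instance (m : ℕ) : Module A (Ω.Form m) where
  smul a x := ⟨Ω.incl a * x.val, Ω.incl_mul_mem a x.val_mem⟩
  one_smul x := Form.ext (by change Ω.incl 1 * x.val = x.val; simp)
  mul_smul a b x := Form.ext (by
    change Ω.incl (a * b) * x.val = Ω.incl a * (Ω.incl b * x.val); simp [mul_assoc])
  smul_zero a := Form.ext (by change Ω.incl a * 0 = 0; simp)
  smul_add a x y := Form.ext (by
    change Ω.incl a * (x.val + y.val) = Ω.incl a * x.val + Ω.incl a * y.val; rw [mul_add])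
  add_smul a b x := Form.ext (by
    change Ω.incl (a + b) * x.val = Ω.incl a * x.val + Ω.incl b * x.val
    rw [map_add, add_mul])
  zero_smul x := Form.ext (by change Ω.incl 0 * x.val = 0; simp)

instance (m : ℕ) : Module Aᵐᵒᵖ (Ω.Form m) where
  smul a x := ⟨x.val * Ω.incl a.unop, Ω.mul_incl_mem a.unop x.val_mem⟩
  one_smul x := Form.ext (by change x.val * Ω.incl 1 = x.val; simp)
  mul_smul a b x := Form.ext (by
    change x.val * Ω.incl (b.unop * a.unop) = x.val * Ω.incl b.unop * Ω.incl a.unop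
    simp [mul_assoc])
  smul_zero a := Form.ext (by change 0 * Ω.incl a.unop = 0; simp)
  smul_add a x y := Form.ext (by
    change (x.val + y.val) * Ω.incl a.unop = x.val * Ω.incl a.unop + y.val * Ω.incl a.unop
    rw [add_mul])
  add_smul a b x := Form.ext (by
    change x.val * Ω.incl (a.unop + b.unop) = x.val * Ω.incl a.unop + x.val * Ω.incl b.unop
    rw [map_add, mul_add])
  zero_smul x := Form.ext (by change x.val * Ω.incl 0 = 0; simp)

variable {Ω} in
theorem Form.val_lsmul {m : ℕ} (a : A) (x : Ω.Form m) : (a • x).val = Ω.incl a * x.val := rfl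

variable {Ω} in
theorem Form.val_rsmul {m : ℕ} (a : A) (x : Ω.Form m) :
    (MulOpposite.op a • x).val = x.val * Ω.incl a := rfl

instance (m : ℕ) : SMulCommClass A Aᵐᵒᵖ (Ω.Form m) where
  smul_comm a b x := Form.ext (by
    change Ω.incl a * (x.val * Ω.incl b.unop) = Ω.incl a * x.val * Ω.incl b.unop
    rw [mul_assoc])

instance (m : ℕ) : IsScalarTower k A (Ω.Form m) where
  smul_assoc c a x := Form.ext (by
    change Ω.incl (c • a) * x.val = c • (Ω.incl a * x.val)
    rw [map_smul, smul_mul_assoc])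

/-- The wedge product `Ωᵖ × Ω^q → Ω^{p+q}`. -/
def wedge (p q : ℕ) : Ω.Form p →ₗ[k] Ω.Form q →ₗ[k] Ω.Form (p + q) :=
  LinearMap.mk₂ k (fun x y => ⟨x.val * y.val, Ω.mul_mem x.val_mem y.val_mem⟩)
    (fun x x' y => Form.ext (add_mul x.val x'.val y.val))
    (fun c x y => Form.ext (smul_mul_assoc c x.val y.val))
    (fun x y y' => Form.ext (mul_add x.val y.val y'.val))
    (fun c x y => Form.ext (mul_smul_comm c x.val y.val))

theorem val_wedge (p q : ℕ) (x : Ω.Form p) (y : Ω.Form q) :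
    (Ω.wedge p q x y).val = x.val * y.val := rfl

/-- The exterior derivative `d : Ωᵐ → Ω^{m+1}`. -/
def dForm (m : ℕ) : Ω.Form m →ₗ[k] Ω.Form (m + 1) where
  toFun x := ⟨Ω.d x.val, Ω.d_mem m _ x.val_mem⟩
  map_add' x y := Form.ext (Ω.d.map_add x.val y.val)
  map_smul' c x := Form.ext (Ω.d.map_smul c x.val)

theorem val_dForm (m : ℕ) (x : Ω.Form m) : (Ω.dForm m x).val = Ω.d x.val := rfl

/-- The derivation `d : A → Ω¹`. -/
def dA : A →ₗ[k] Ω.Form 1 where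
  toFun a := ⟨Ω.d (Ω.incl a), by simpa using Ω.d_mem 0 _ (Ω.incl_mem a)⟩
  map_add' x y := Form.ext (by
    change Ω.d (Ω.incl (x + y)) = Ω.d (Ω.incl x) + Ω.d (Ω.incl y); simp)
  map_smul' c x := Form.ext (by
    change Ω.d (Ω.incl (c • x)) = c • Ω.d (Ω.incl x); simp)

theorem val_dA (a : A) : (Ω.dA a).val = Ω.d (Ω.incl a) := rfl

theorem d_incl_mul (a : A) (x : Ω.carrier) :
    Ω.d (Ω.incl a * x) = Ω.d (Ω.incl a) * x + Ω.incl a * Ω.d x := by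
  rw [Ω.d_mul 0 _ _ (Ω.incl_mem a)]; simp

section Jet1A

/-- The left `A`-linear map `A ⊗[k] A → A`, `a ⊗ b ↦ a b`. -/
def mulMap (k : Type v) (A : Type u) [CommRing k] [Ring A] [Algebra k A] : A ⊗[k] A →ₗ[A] A :=
  TensorProduct.AlgebraTensorModule.lift
    (LinearMap.toSpanSingleton A (A →ₗ[k] A) LinearMap.id)

/-- The left `A`-linear map `A ⊗[k] A → Ω¹`, `a ⊗ b ↦ a db`. -/
def adMap : A ⊗[k] A →ₗ[A] Ω.Form 1 :=
  TensorProduct.AlgebraTensorModule.lift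
    (LinearMap.toSpanSingleton A (A →ₗ[k] Ω.Form 1) Ω.dA)

theorem mulMap_tmul (a b : A) : mulMap k A (a ⊗ₜ[k] b) = a * b := rfl

theorem adMap_tmul (a b : A) : Ω.adMap (a ⊗ₜ[k] b) = a • Ω.dA b := rfl

/-- The submodule `N_d ⊆ A ⊗ A` of all `∑ aᵢ ⊗ bᵢ` with `∑ aᵢ bᵢ = 0` and `∑ aᵢ dbᵢ = 0`. -/
def Nd : Submodule A (A ⊗[k] A) := LinearMap.ker (mulMap k A) ⊓ LinearMap.ker Ω.adMap

/-- The `A`-bimodule of `1`-jets `J¹A = (A ⊗ A) / N_d`. -/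
def Jet1A : Type u := (A ⊗[k] A) ⧸ Ω.Nd

instance : AddCommGroup Ω.Jet1A := inferInstanceAs (AddCommGroup ((A ⊗[k] A) ⧸ Ω.Nd))
instance : Module A Ω.Jet1A := inferInstanceAs (Module A ((A ⊗[k] A) ⧸ Ω.Nd))
instance : Module k Ω.Jet1A := inferInstanceAs (Module k ((A ⊗[k] A) ⧸ Ω.Nd))
instance : IsScalarTower k A Ω.Jet1A :=
  inferInstanceAs (IsScalarTower k A ((A ⊗[k] A) ⧸ Ω.Nd))

/-- The class `[a ⊗ b]` in `J¹A`. -/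
def jc (a b : A) : Ω.Jet1A := Ω.Nd.mkQ (a ⊗ₜ[k] b)

variable {Ω} in
@[elab_as_elim]
theorem Jet1A.induction {p : Ω.Jet1A → Prop} (x : Ω.Jet1A)
    (tmul : ∀ a b, p (Ω.jc a b)) (add : ∀ x y, p x → p y → p (x + y)) : p x := by
  obtain ⟨t, rfl⟩ := Submodule.Quotient.mk_surjective _ x
  induction t with
  | zero => have h := tmul 0 0; simpa [jc] using h
  | tmul m n => exact tmul m n
  | add s t hs ht => exact add _ _ hs ht

/-- Right multiplication `a ⊗ b ↦ a ⊗ b c` on `A ⊗[k] A`. -/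
def rmulAA (k : Type v) {A : Type u} [CommRing k] [Ring A] [Algebra k A] (c : A) :
    A ⊗[k] A →ₗ[A] A ⊗[k] A :=
  TensorProduct.AlgebraTensorModule.lTensor A A (LinearMap.mulRight k c)

theorem rmulAA_tmul (c a b : A) : rmulAA k c (a ⊗ₜ[k] b) = a ⊗ₜ[k] (b * c) := rfl

theorem adMap_rmulAA (c : A) (t : A ⊗[k] A) :
    Ω.adMap (rmulAA k c t) = MulOpposite.op c • Ω.adMap t + mulMap k A t • Ω.dA c := by
  induction t with
  | zero => simp
  | tmul a b =>
    rw [rmulAA_tmul, adMap_tmul, adMap_tmul, mulMap_tmul]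
    apply Form.ext
    simp only [Form.val_add, Form.val_lsmul, Form.val_rsmul, val_dA, map_mul, d_incl_mul]
    noncomm_ring
  | add s t hs ht => simp only [map_add, hs, ht, smul_add, add_smul]; abel

theorem mulMap_rmulAA (c : A) (t : A ⊗[k] A) :
    mulMap k A (rmulAA k c t) = mulMap k A t * c := by
  induction t with
  | zero => simp
  | tmul a b => rw [rmulAA_tmul, mulMap_tmul, mulMap_tmul, mul_assoc]
  | add s t hs ht => simp only [map_add, hs, ht, add_mul]

/-- The right action `[a ⊗ b] c = [a ⊗ b c]` of `c` on `J¹A`. -/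
def rmulJ (c : A) : Ω.Jet1A →ₗ[A] Ω.Jet1A :=
  Submodule.mapQ Ω.Nd Ω.Nd (rmulAA k c) (by
    intro t ht
    obtain ⟨h1, h2⟩ := ht
    have h1' : mulMap k A t = 0 := h1
    have h2' : Ω.adMap t = 0 := h2
    refine ⟨?_, ?_⟩
    · change mulMap k A (rmulAA k c t) = 0
      rw [mulMap_rmulAA, h1', zero_mul]
    · change Ω.adMap (rmulAA k c t) = 0
      rw [adMap_rmulAA, h1', h2', smul_zero, zero_smul, add_zero])

theorem rmulJ_jc (c a b : A) : Ω.rmulJ c (Ω.jc a b) = Ω.jc a (b * c) := rfl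

instance : Module Aᵐᵒᵖ Ω.Jet1A where
  smul c x := Ω.rmulJ c.unop x
  one_smul x := by
    change Ω.rmulJ 1 x = x
    induction x using Jet1A.induction with
    | tmul a b => rw [rmulJ_jc, mul_one]
    | add x y hx hy => rw [map_add, hx, hy]
  mul_smul c e x := by
    change Ω.rmulJ (e.unop * c.unop) x = Ω.rmulJ c.unop (Ω.rmulJ e.unop x)
    induction x using Jet1A.induction with
    | tmul a b => rw [rmulJ_jc, rmulJ_jc, rmulJ_jc, mul_assoc]
    | add x y hx hy => simp only [map_add, hx, hy]
  smul_zero c := map_zero (Ω.rmulJ c.unop)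
  smul_add c x y := map_add (Ω.rmulJ c.unop) x y
  add_smul c e x := by
    change Ω.rmulJ (c.unop + e.unop) x = Ω.rmulJ c.unop x + Ω.rmulJ e.unop x
    induction x using Jet1A.induction with
    | tmul a b =>
      rw [rmulJ_jc, rmulJ_jc, rmulJ_jc, mul_add]
      simp only [jc, TensorProduct.tmul_add, map_add]; rfl
    | add x y hx hy => simp only [map_add, hx, hy]; abel
  zero_smul x := by
    change Ω.rmulJ 0 x = 0
    induction x using Jet1A.induction with
    | tmul a b => rw [rmulJ_jc, mul_zero]; simp only [jc, TensorProduct.tmul_zero, map_zero]; rfl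
    | add x y hx hy => rw [map_add, hx, hy, add_zero]

theorem op_smul_jc (c a b : A) : MulOpposite.op c • Ω.jc a b = Ω.jc a (b * c) := rfl

theorem smul_jc (c a b : A) : c • Ω.jc a b = Ω.jc (c * a) b := rfl

instance : SMulCommClass A Aᵐᵒᵖ Ω.Jet1A where
  smul_comm a c x := ((Ω.rmulJ c.unop).map_smul a x).symm

variable {Ω} in
/-- A `k`-linear map out of `J¹A = (A ⊗ A) / N_d` induced by a map on `A ⊗ A` vanishing on `N_d`. -/
def Jet1A.lift {P : Type u} [AddCommGroup P] [Module k P] (f : A →ₗ[k] A →ₗ[k] P)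
    (hf : ∀ t : A ⊗[k] A, mulMap k A t = 0 → Ω.adMap t = 0 → TensorProduct.lift f t = 0) :
    Ω.Jet1A →ₗ[k] P :=
  ((Ω.Nd.restrictScalars k).liftQ (TensorProduct.lift f) (fun t ht => hf t ht.1 ht.2)) ∘ₗ
    (Submodule.Quotient.restrictScalarsEquiv k Ω.Nd).symm.toLinearMap

variable {Ω} in
theorem Jet1A.lift_jc {P : Type u} [AddCommGroup P] [Module k P] (f : A →ₗ[k] A →ₗ[k] P)
    (hf : ∀ t : A ⊗[k] A, mulMap k A t = 0 → Ω.adMap t = 0 → TensorProduct.lift f t = 0)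
    (a b : A) : Jet1A.lift f hf (Ω.jc a b) = f a b := rfl

end Jet1A

/-- The map `Ωᵐ × J¹A → Ω^{m+1}`, `(ω, [y ⊗ z]) ↦ d(ω y) z`. -/
def spencerA (m : ℕ) : Ω.Form m →ₗ[k] Ω.Jet1A →ₗ[k] Ω.Form (m + 1) :=
  let f (ω : Ω.Form m) : A →ₗ[k] A →ₗ[k] Ω.Form (m + 1) :=
    LinearMap.mk₂ k (fun y z => MulOpposite.op z • Ω.dForm m (MulOpposite.op y • ω))
      (fun y y' z => by rw [MulOpposite.op_add, add_smul, map_add, smul_add])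
      (fun c y z => Form.ext (by
        simp only [Form.val_rsmul, val_dForm, Form.val_smul, map_smul, mul_smul_comm,
          smul_mul_assoc]))
      (fun y z z' => by rw [MulOpposite.op_add, add_smul])
      (fun c y z => Form.ext (by
        simp only [Form.val_rsmul, Form.val_smul, map_smul, mul_smul_comm]))
  have hf (ω : Ω.Form m) (t : A ⊗[k] A) : (TensorProduct.lift (f ω) t).val =
      Ω.d ω.val * Ω.incl (mulMap k A t) +
        (-1) ^ m * (ω.val * (Ω.d (Ω.incl (mulMap k A t)) - (Ω.adMap t).val)) := by
    induction t with
    | zero => simp [Form.val_zero]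
    | tmul y z =>
      change Ω.d (ω.val * Ω.incl y) * Ω.incl z = _
      rw [mulMap_tmul, adMap_tmul, Form.val_lsmul, val_dA, map_mul Ω.incl, d_incl_mul,
        Ω.d_mul m _ _ ω.val_mem]
      noncomm_ring
    | add s t hs ht =>
      simp only [map_add, Form.val_add, hs, ht]
      noncomm_ring
  { toFun := fun ω => Jet1A.lift (f ω) (fun t h1 h2 => Form.ext (by
      rw [hf, h1, h2]; simp [Form.val_zero]))
    map_add' := fun ω ω' => by
      ext x
      induction x using Jet1A.induction with
      | tmul y z =>
        change MulOpposite.op z • Ω.dForm m (MulOpposite.op y • (ω + ω')) =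
          MulOpposite.op z • Ω.dForm m (MulOpposite.op y • ω) +
          MulOpposite.op z • Ω.dForm m (MulOpposite.op y • ω')
        rw [smul_add, map_add, smul_add]
      | add s t hs ht => rw [map_add, hs, ht, map_add]
    map_smul' := fun c ω => by
      ext x
      induction x using Jet1A.induction with
      | tmul y z =>
        change MulOpposite.op z • Ω.dForm m (MulOpposite.op y • (c • ω)) =
          c • (MulOpposite.op z • Ω.dForm m (MulOpposite.op y • ω))
        exact Form.ext (by
          simp only [Form.val_rsmul, val_dForm, Form.val_smul, map_smul, smul_mul_assoc])
      | add s t hs ht => rw [map_add, hs, ht, map_add] }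

theorem spencerA_jc (m : ℕ) (ω : Ω.Form m) (y z : A) :
    Ω.spencerA m ω (Ω.jc y z) = MulOpposite.op z • Ω.dForm m (MulOpposite.op y • ω) := rfl

/-- The map `J¹A → Ω¹`, `[c ⊗ c'] ↦ (dc) c'`. -/
def sigmaA : Ω.Jet1A →ₗ[k] Ω.Form 1 :=
  let f : A →ₗ[k] A →ₗ[k] Ω.Form 1 :=
    LinearMap.mk₂ k (fun c c' => MulOpposite.op c' • Ω.dA c)
      (fun y y' z => by rw [map_add, smul_add])
      (fun c y z => Form.ext (by
        simp only [Form.val_rsmul, Form.val_smul, map_smul, smul_mul_assoc]))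
      (fun y z z' => by rw [MulOpposite.op_add, add_smul])
      (fun c y z => Form.ext (by
        simp only [Form.val_rsmul, Form.val_smul, map_smul, mul_smul_comm]))
  have hf (t : A ⊗[k] A) : TensorProduct.lift f t = Ω.dA (mulMap k A t) - Ω.adMap t := by
    induction t with
    | zero => simp
    | tmul y z =>
      apply Form.ext
      change Ω.d (Ω.incl y) * Ω.incl z = Ω.d (Ω.incl (y * z)) - Ω.incl y * Ω.d (Ω.incl z)
      rw [map_mul, d_incl_mul]; noncomm_ring
    | add s t hs ht => simp only [map_add, hs, ht]; abel
  Jet1A.lift f (fun t h1 h2 => by rw [hf, h1, h2]; simp)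

theorem sigmaA_jc (c c' : A) : Ω.sigmaA (Ω.jc c c') = MulOpposite.op c' • Ω.dA c := rfl

/-- The map `J¹A × J¹A → Ω¹`, `([a ⊗ b], [c ⊗ c']) ↦ a d(b c) c'`. -/
def tildeDIA : Ω.Jet1A →ₗ[k] Ω.Jet1A →ₗ[k] Ω.Form 1 :=
  let f : A →ₗ[k] A →ₗ[k] (Ω.Jet1A →ₗ[k] Ω.Form 1) :=
    LinearMap.mk₂ k
      (fun a b => Algebra.lsmul k k (Ω.Form 1) a ∘ₗ Ω.sigmaA ∘ₗ Algebra.lsmul k k Ω.Jet1A b)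
      (fun a a' b => by rw [map_add]; exact LinearMap.add_comp _ _ _)
      (fun c a b => by rw [map_smul]; exact LinearMap.smul_comp _ _ _)
      (fun a b b' => by rw [map_add, LinearMap.comp_add, LinearMap.comp_add])
      (fun c a b => by rw [map_smul, LinearMap.comp_smul, LinearMap.comp_smul])
  have hf (t : A ⊗[k] A) (c c' : A) : TensorProduct.lift f t (Ω.jc c c') =
      MulOpposite.op (c * c') • Ω.adMap t + mulMap k A t • MulOpposite.op c' • Ω.dA c := by
    induction t with
    | zero => simp
    | tmul a b =>
      apply Form.ext
      change Ω.incl a * (Ω.d (Ω.incl (b * c)) * Ω.incl c') =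
        (Ω.incl a * Ω.d (Ω.incl b)) * Ω.incl (c * c') +
          Ω.incl (a * b) * (Ω.d (Ω.incl c) * Ω.incl c')
      rw [map_mul Ω.incl, map_mul Ω.incl, map_mul Ω.incl, d_incl_mul]; noncomm_ring
    | add s t hs ht =>
      simp only [map_add, LinearMap.add_apply, hs, ht, smul_add, add_smul]; abel
  Jet1A.lift f (fun t h1 h2 => by
    ext y
    induction y using Jet1A.induction with
    | tmul c c' => rw [hf, h1, h2]; simp
    | add s t hs ht => rw [map_add, hs, ht, map_add])

theorem tildeDIA_jc (a b c c' : A) : Ω.tildeDIA (Ω.jc a b) (Ω.jc c c') =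
    a • MulOpposite.op c' • Ω.dA (b * c) := rfl

/-- The map `J¹A × J¹A → Ω²`, `([a ⊗ b], [c ⊗ c']) ↦ da ∧ d(b c) c'`. -/
def tildeDIIA : Ω.Jet1A →ₗ[k] Ω.Jet1A →ₗ[k] Ω.Form 2 :=
  let f : A →ₗ[k] A →ₗ[k] (Ω.Jet1A →ₗ[k] Ω.Form 2) :=
    LinearMap.mk₂ k
      (fun a b => Ω.wedge 1 1 (Ω.dA a) ∘ₗ Ω.sigmaA ∘ₗ Algebra.lsmul k k Ω.Jet1A b)
      (fun a a' b => by rw [map_add, map_add]; exact LinearMap.add_comp _ _ _)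
      (fun c a b => by rw [map_smul, map_smul]; exact LinearMap.smul_comp _ _ _)
      (fun a b b' => by rw [map_add, LinearMap.comp_add, LinearMap.comp_add])
      (fun c a b => by rw [map_smul, LinearMap.comp_smul, LinearMap.comp_smul])
  have hf (t : A ⊗[k] A) (c c' : A) : (TensorProduct.lift f t (Ω.jc c c')).val =
      Ω.d (Ω.adMap t).val * Ω.incl (c * c') +
        (Ω.d (Ω.incl (mulMap k A t)) - (Ω.adMap t).val) * (Ω.d (Ω.incl c) * Ω.incl c') := by
    induction t with
    | zero => simp [Form.val_zero]
    | tmul a b =>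
      change Ω.d (Ω.incl a) * (Ω.d (Ω.incl (b * c)) * Ω.incl c') =
        Ω.d (Ω.incl a * Ω.d (Ω.incl b)) * Ω.incl (c * c') +
        (Ω.d (Ω.incl (a * b)) - Ω.incl a * Ω.d (Ω.incl b)) * (Ω.d (Ω.incl c) * Ω.incl c')
      rw [map_mul Ω.incl, map_mul Ω.incl, map_mul Ω.incl, d_incl_mul, d_incl_mul, d_incl_mul, Ω.d_d]; noncomm_ring
    | add s t hs ht =>
      simp only [map_add, LinearMap.add_apply, hs, ht, Form.val_add]; noncomm_ring
  Jet1A.lift f (fun t h1 h2 => by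
    ext y
    induction y using Jet1A.induction with
    | tmul c c' => exact Form.ext (by rw [hf, h1, h2]; simp [Form.val_zero])
    | add s t hs ht => rw [map_add, hs, ht, map_add])

theorem tildeDIIA_jc (a b c c' : A) : Ω.tildeDIIA (Ω.jc a b) (Ω.jc c c') =
    Ω.wedge 1 1 (Ω.dA a) (MulOpposite.op c' • Ω.dA (b * c)) := rfl

/-- The left `A`-module `ΩᵐE = Ωᵐ ⊗_A E` of `m`-forms with values in `E`. -/
abbrev FormMod (m : ℕ) (E : LMod k A) : LMod k A where
  carrier := BTensor k A (Ω.Form m) E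

/-- The action `Ωᵐ(f)` of the functor `Ωᵐ ⊗_A -` on morphisms. -/
abbrev formMap (m : ℕ) {E E' : LMod k A} (f : E →ₗ[A] E') :
    Ω.FormMod m E →ₗ[A] Ω.FormMod m E' :=
  BTensor.mapRight (k := k) (Ω.Form m) f

/-- The left `A`-module of `1`-jets `J¹E = J¹A ⊗_A E`. -/
abbrev Jet1 (E : LMod k A) : LMod k A where
  carrier := BTensor k A Ω.Jet1A E

/-- The action `J¹(f)` of the functor `J¹ = J¹A ⊗_A -` on morphisms. -/
abbrev jet1Map {E E' : LMod k A} (f : E →ₗ[A] E') : Ω.Jet1 E →ₗ[A] Ω.Jet1 E' :=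
  BTensor.mapRight (k := k) Ω.Jet1A f

/-- The first order Spencer operator `S^{1,m}_E : Ωᵐ J¹E → Ω^{m+1} E`,
`ω ⊗ [y ⊗ z] ⊗ e ↦ d(ω y) z ⊗ e`. -/
def spencer1 (m : ℕ) (E : LMod k A) : Ω.FormMod m (Ω.Jet1 E) →ₗ[k] Ω.FormMod (m + 1) E :=
  BTensor.lift₂ E (Ω.spencerA m)
    (fun ω a x => by
      induction x using Jet1A.induction with
      | tmul y z => rw [smul_jc, spencerA_jc, spencerA_jc, MulOpposite.op_mul, mul_smul]
      | add s t hs ht => rw [map_add, hs, ht, smul_add, map_add])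
    (fun ω a x => by
      induction x using Jet1A.induction with
      | tmul y z => rw [op_smul_jc, spencerA_jc, spencerA_jc, MulOpposite.op_mul, mul_smul]
      | add s t hs ht => rw [map_add, smul_add, map_add, hs, ht, smul_add])

theorem spencer1_bt (m : ℕ) (E : LMod k A) (ω : Ω.Form m) (y z : A) (e : E) :
    Ω.spencer1 m E (bt ω (bt (Ω.jc y z) e)) =
      bt (MulOpposite.op z • Ω.dForm m (MulOpposite.op y • ω)) e := rfl

/-- The left `A`-linear map `D̃ᴵ_E : J¹J¹E → Ω¹E`,
`[a ⊗ b] ⊗ [c ⊗ c'] ⊗ e ↦ a d(b c) c' ⊗ e`. -/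
def tildeDI (E : LMod k A) : Ω.Jet1 (Ω.Jet1 E) →ₗ[A] Ω.FormMod 1 E :=
  let F : BTensor k A Ω.Jet1A (BTensor k A Ω.Jet1A E) →ₗ[k] BTensor k A (Ω.Form 1) E :=
    BTensor.lift₂ E Ω.tildeDIA
      (fun x r y => by
        induction x using Jet1A.induction with
        | tmul a b =>
          induction y using Jet1A.induction with
          | tmul c c' => rw [op_smul_jc, smul_jc, tildeDIA_jc, tildeDIA_jc, mul_assoc]
          | add s t hs ht => rw [map_add, hs, ht, smul_add, map_add]
        | add s t hs ht => simp only [smul_add, map_add, LinearMap.add_apply, hs, ht])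
      (fun x r y => by
        induction x using Jet1A.induction with
        | tmul a b =>
          induction y using Jet1A.induction with
          | tmul c c' =>
            rw [op_smul_jc, tildeDIA_jc, tildeDIA_jc, MulOpposite.op_mul, mul_smul, smul_comm]
          | add s t hs ht => rw [smul_add, map_add, hs, ht, map_add, smul_add]
        | add s t hs ht => simp only [smul_add, map_add, LinearMap.add_apply, hs, ht])
  { toFun := F
    map_add' := F.map_add
    map_smul' := fun r t => by
      induction t using BTensor.induction with
      | tmul x t =>
        induction t using BTensor.induction with
        | tmul y e =>
          induction x using Jet1A.induction with
          | tmul a b =>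
            induction y using Jet1A.induction with
            | tmul c c' =>
              rw [← bt_smul_left, smul_jc]
              change bt ((r * a) • MulOpposite.op c' • Ω.dA (b * c)) e =
                r • bt (a • MulOpposite.op c' • Ω.dA (b * c)) e
              rw [mul_smul, bt_smul_left]
            | add s t hs ht =>
              simp only [bt_add_left, bt_add_right, smul_add, map_add, hs, ht]
          | add s t hs ht => simp only [bt_add_left, smul_add, map_add, hs, ht]
        | add s t hs ht => simp only [bt_add_right, smul_add, map_add, hs, ht]
      | add s t hs ht => simp only [smul_add, map_add, hs, ht] }

theorem tildeDI_bt (E : LMod k A) (a b c c' : A) (e : E) :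
    Ω.tildeDI E (bt (Ω.jc a b) (bt (Ω.jc c c') e)) =
      bt (a • MulOpposite.op c' • Ω.dA (b * c)) e := rfl

/-- The `k`-linear map `D̃ᴵᴵ_E : J¹J¹E → Ω²E`,
`[a ⊗ b] ⊗ [c ⊗ c'] ⊗ e ↦ da ∧ d(b c) c' ⊗ e`. -/
def tildeDII (E : LMod k A) : Ω.Jet1 (Ω.Jet1 E) →ₗ[k] Ω.FormMod 2 E :=
  BTensor.lift₂ E Ω.tildeDIIA
    (fun x r y => by
      induction x using Jet1A.induction with
      | tmul a b =>
        induction y using Jet1A.induction with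
        | tmul c c' => rw [op_smul_jc, smul_jc, tildeDIIA_jc, tildeDIIA_jc, mul_assoc]
        | add s t hs ht => rw [map_add, hs, ht, smul_add, map_add]
      | add s t hs ht => simp only [smul_add, map_add, LinearMap.add_apply, hs, ht])
    (fun x r y => by
      induction x using Jet1A.induction with
      | tmul a b =>
        induction y using Jet1A.induction with
        | tmul c c' =>
          rw [op_smul_jc, tildeDIIA_jc, tildeDIIA_jc, MulOpposite.op_mul, mul_smul]
          exact Form.ext (mul_assoc _ _ _).symm
        | add s t hs ht => rw [smul_add, map_add, hs, ht, map_add, smul_add]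
      | add s t hs ht => simp only [smul_add, map_add, LinearMap.add_apply, hs, ht])

theorem tildeDII_bt (E : LMod k A) (a b c c' : A) (e : E) :
    Ω.tildeDII E (bt (Ω.jc a b) (bt (Ω.jc c c') e)) =
      bt (Ω.wedge 1 1 (Ω.dA a) (MulOpposite.op c' • Ω.dA (b * c)) : Ω.Form 2) e := rfl

/-- The map `α ↦ dr ∧ α`, `Ω¹E → Ω²E`, for `r ∈ A`. -/
def dWedge (E : LMod k A) (r : A) : Ω.FormMod 1 E →ₗ[k] Ω.FormMod 2 E :=
  BTensor.mapLeft E (M' := Ω.Form 2) (Ω.wedge 1 1 (Ω.dA r))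
    (fun _ _ => Form.ext (mul_assoc _ _ _).symm)

theorem dWedge_bt (E : LMod k A) (r : A) (ω : Ω.Form 1) (e : E) :
    Ω.dWedge E r (bt ω e) = bt (Ω.wedge 1 1 (Ω.dA r) ω : Ω.Form 2) e := rfl

theorem dWedge_one (E : LMod k A) (x : Ω.FormMod 1 E) : Ω.dWedge E 1 x = 0 := by
  induction x using BTensor.induction with
  | tmul ω e =>
    have h : Ω.dA 1 = 0 := Form.ext (by
      have := Ω.d_incl_mul 1 1
      simp only [map_one, one_mul, mul_one] at this
      rw [val_dA, map_one, Form.val_zero]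
      simpa using this)
    rw [dWedge_bt, h, map_zero, LinearMap.zero_apply]
    have := bt_ksmul_left (A := A) (0 : k) (0 : Ω.Form 2) e
    simpa using this
  | add x y hx hy => rw [map_add, hx, hy, add_zero]

theorem dWedge_mul (E : LMod k A) (r s : A) (x : Ω.FormMod 1 E) :
    Ω.dWedge E (r * s) x = Ω.dWedge E r (s • x) + r • Ω.dWedge E s x := by
  induction x using BTensor.induction with
  | tmul ω e =>
    rw [← bt_smul_left, dWedge_bt, dWedge_bt, dWedge_bt, ← bt_smul_left, ← bt_add_left]
    congr 1
    apply Form.ext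
    change Ω.d (Ω.incl (r * s)) * ω.val =
      Ω.d (Ω.incl r) * (Ω.incl s * ω.val) + Ω.incl r * (Ω.d (Ω.incl s) * ω.val)
    rw [map_mul Ω.incl, d_incl_mul]; noncomm_ring
  | add x y hx hy => simp only [map_add, smul_add, hx, hy]; abel

theorem dWedge_add (E : LMod k A) (r s : A) (x : Ω.FormMod 1 E) :
    Ω.dWedge E (r + s) x = Ω.dWedge E r x + Ω.dWedge E s x := by
  induction x using BTensor.induction with
  | tmul ω e =>
    rw [dWedge_bt, dWedge_bt, dWedge_bt, ← bt_add_left, map_add, map_add]; rfl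
  | add x y hx hy => simp only [map_add, hx, hy]; abel

/-- The `k`-module underlying `(Ω¹ ⋉ Ω²)E`, namely `Ω¹E ⊕ Ω²E`. -/
def SemiForm (E : LMod k A) : Type u := Ω.FormMod 1 E × Ω.FormMod 2 E

instance (E : LMod k A) : AddCommGroup (Ω.SemiForm E) :=
  inferInstanceAs (AddCommGroup (Ω.FormMod 1 E × Ω.FormMod 2 E))
instance (E : LMod k A) : Module k (Ω.SemiForm E) :=
  inferInstanceAs (Module k (Ω.FormMod 1 E × Ω.FormMod 2 E))

/-- The left `A`-action on `(Ω¹ ⋉ Ω²)E` is `r (α + β) = r α + (dr ∧ α + r β)`. -/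
instance (E : LMod k A) : Module A (Ω.SemiForm E) where
  smul r x := (r • x.1, Ω.dWedge E r x.1 + r • x.2)
  one_smul x := by
    change ((1 : A) • x.1, Ω.dWedge E 1 x.1 + (1 : A) • x.2) = x
    rw [dWedge_one, one_smul, one_smul, zero_add]; rfl
  mul_smul r s x := by
    change ((r * s) • x.1, Ω.dWedge E (r * s) x.1 + (r * s) • x.2) =
      (r • s • x.1, Ω.dWedge E r (s • x.1) + r • (Ω.dWedge E s x.1 + s • x.2))
    rw [dWedge_mul, mul_smul, mul_smul, smul_add, add_assoc]
  smul_zero r := by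
    change (r • (0 : Ω.FormMod 1 E), Ω.dWedge E r 0 + r • (0 : Ω.FormMod 2 E)) = (0, 0)
    rw [map_zero, smul_zero, smul_zero, add_zero]
  smul_add r x y := by
    change (r • (x.1 + y.1), Ω.dWedge E r (x.1 + y.1) + r • (x.2 + y.2)) =
      (r • x.1 + r • y.1, (Ω.dWedge E r x.1 + r • x.2) + (Ω.dWedge E r y.1 + r • y.2))
    rw [map_add, smul_add, smul_add, add_add_add_comm]
  add_smul r s x := by
    change ((r + s) • x.1, Ω.dWedge E (r + s) x.1 + (r + s) • x.2) =
      (r • x.1 + s • x.1, (Ω.dWedge E r x.1 + r • x.2) + (Ω.dWedge E s x.1 + s • x.2))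
    rw [dWedge_add, add_smul, add_smul, add_add_add_comm]
  zero_smul x := by
    change ((0 : A) • x.1, Ω.dWedge E 0 x.1 + (0 : A) • x.2) = (0, 0)
    have h : Ω.dWedge E 0 x.1 = 0 := by
      have h := Ω.dWedge_add E 0 0 x.1
      rw [add_zero] at h
      simpa using h
    rw [h, zero_smul, zero_smul, add_zero]

theorem tildeDII_smul (E : LMod k A) (r : A) (t : Ω.Jet1 (Ω.Jet1 E)) :
    Ω.tildeDII E (r • t) = Ω.dWedge E r (Ω.tildeDI E t) + r • Ω.tildeDII E t := by
  induction t using BTensor.induction with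
  | tmul x t =>
    induction t using BTensor.induction with
    | tmul y e =>
      induction x using Jet1A.induction with
      | tmul a b =>
        induction y using Jet1A.induction with
        | tmul c c' =>
          rw [← bt_smul_left, smul_jc, tildeDII_bt, tildeDII_bt, tildeDI_bt, dWedge_bt,
            ← bt_smul_left, ← bt_add_left]
          congr 1
          apply Form.ext
          change Ω.d (Ω.incl (r * a)) * (Ω.d (Ω.incl (b * c)) * Ω.incl c') =
            Ω.d (Ω.incl r) * (Ω.incl a * (Ω.d (Ω.incl (b * c)) * Ω.incl c')) +
              Ω.incl r * (Ω.d (Ω.incl a) * (Ω.d (Ω.incl (b * c)) * Ω.incl c'))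
          rw [map_mul Ω.incl r, d_incl_mul]; noncomm_ring
        | add s t hs ht =>
          simp only [bt_add_left, bt_add_right, smul_add, map_add, hs, ht]; abel
      | add s t hs ht => simp only [bt_add_left, smul_add, map_add, hs, ht]; abel
    | add s t hs ht => simp only [bt_add_right, smul_add, map_add, hs, ht]; abel
  | add s t hs ht => simp only [smul_add, map_add, hs, ht]; abel

/-- The left `A`-linear map `D̃_E = (D̃ᴵ_E, D̃ᴵᴵ_E) : J¹J¹E → (Ω¹ ⋉ Ω²)E`. -/
def tildeD (E : LMod k A) : Ω.Jet1 (Ω.Jet1 E) →ₗ[A] Ω.SemiForm E where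
  toFun t := (Ω.tildeDI E t, Ω.tildeDII E t)
  map_add' s t := by rw [map_add, map_add]; rfl
  map_smul' r t := by rw [map_smul, tildeDII_smul]; rfl

/-- The submodule of a left `A`-module, as a left `A`-module. -/
abbrev ofSubmodule (M : LMod k A) (S : Submodule A M) : LMod k A where
  carrier := S

/-- Two consecutive holonomic jet modules `lo = JⁿE`, `hi = J^{n+1}E`, and the map
`l : J^{n+1}E → J¹JⁿE`. -/
structure JetStage where
  /-- `JⁿE` -/
  lo : LMod k A
  /-- `J^{n+1}E` -/
  hi : LMod k A
  /-- `J^{n+1}E → J¹JⁿE` -/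
  l : hi →ₗ[A] Ω.Jet1 lo

/-- The recursive construction of the holonomic jets: `J⁰E = E`, `J¹E = J¹A ⊗_A E`, and
`J^{n+2}E ⊆ J¹J^{n+1}E` is the kernel of
`J¹J^{n+1}E → J¹J¹JⁿE → (Ω¹ ⋉ Ω²)JⁿE`, the composite of `J¹(l)` and `D̃`. -/
def jetStage (E : LMod k A) : ℕ → Ω.JetStage
  | 0 => { lo := E, hi := Ω.Jet1 E, l := LinearMap.id }
  | n + 1 =>
    { lo := (jetStage E n).hi
      hi := ofSubmodule (Ω.Jet1 (jetStage E n).hi)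
        (LinearMap.ker (Ω.tildeD (jetStage E n).lo ∘ₗ Ω.jet1Map (jetStage E n).l))
      l := Submodule.subtype _ }

/-- The holonomic `n`-jet module `JⁿE`. -/
def J (n : ℕ) (E : LMod k A) : LMod k A := (Ω.jetStage E n).lo

/-- The map `l^{1,n} : J^{n+1}E → J¹JⁿE`: the identity for `n = 0`, the kernel inclusion for
`n ≥ 1`. -/
def l (n : ℕ) (E : LMod k A) : Ω.J (n + 1) E →ₗ[A] Ω.Jet1 (Ω.J n E) := (Ω.jetStage E n).l

theorem J_zero (E : LMod k A) : Ω.J 0 E = E := rfl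

theorem J_one (E : LMod k A) : Ω.J 1 E = Ω.Jet1 E := rfl

theorem J_add_two (n : ℕ) (E : LMod k A) : Ω.J (n + 2) E =
    ofSubmodule (Ω.Jet1 (Ω.J (n + 1) E))
      (LinearMap.ker (Ω.tildeD (Ω.J n E) ∘ₗ Ω.jet1Map (Ω.l n E))) := rfl

/-- The sesquiholonomic `n`-jet module `J^{n}E`: it is `E` for `n = 0` and `J¹E` for `n = 1`, and
`J^{n+2}E ⊆ J¹J^{n+1}E` (with `J^{n+1}E` holonomic) is the kernel of
`J¹J^{n+1}E → J¹J¹JⁿE → Ω¹JⁿE`, the composite of `J¹(l)` and `D̃ᴵ`. -/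
def sJ : ℕ → LMod k A → LMod k A
  | 0, E => E
  | 1, E => Ω.Jet1 E
  | n + 2, E => ofSubmodule (Ω.Jet1 (Ω.J (n + 1) E))
      (LinearMap.ker (Ω.tildeDI (Ω.J n E) ∘ₗ Ω.jet1Map (Ω.l n E)))

/-- The map `l^{{n+1}}` from sesquiholonomic `(n+1)`-jets to `J¹JⁿE`: the identity for `n = 0`, the
kernel inclusion for `n ≥ 1`. -/
def sl : (n : ℕ) → (E : LMod k A) → Ω.sJ (n + 1) E →ₗ[A] Ω.Jet1 (Ω.J n E)
  | 0, _ => LinearMap.id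
  | _ + 1, _ => Submodule.subtype _

/-- The natural inclusion of holonomic into sesquiholonomic `n`-jets: the identity for `n = 0, 1`,
and the inclusion of submodules of `J¹J^{n-1}E` for `n ≥ 2`. -/
def t : (n : ℕ) → (E : LMod k A) → Ω.J n E →ₗ[A] Ω.sJ n E
  | 0, _ => LinearMap.id
  | 1, _ => LinearMap.id
  | n + 2, E => Submodule.inclusion
      (p := LinearMap.ker (Ω.tildeD (Ω.J n E) ∘ₗ Ω.jet1Map (Ω.l n E)))
      (p' := LinearMap.ker (Ω.tildeDI (Ω.J n E) ∘ₗ Ω.jet1Map (Ω.l n E)))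
      (fun _ hx => congrArg Prod.fst hx)

/-- The map from sesquiholonomic `(n+1)`-jets to `J¹` of the sesquiholonomic `n`-jets, the composite
of `l^{{n+1}}` and `J¹` of the inclusion of holonomic into sesquiholonomic `n`-jets. -/
def sl1 (n : ℕ) (E : LMod k A) : Ω.sJ (n + 1) E →ₗ[A] Ω.Jet1 (Ω.sJ n E) :=
  Ω.jet1Map (Ω.t n E) ∘ₗ Ω.sl n E

/-- The holonomic Spencer operator `S^{n+1,m}_E : Ωᵐ J^{n+1}E → Ω^{m+1} JⁿE`. -/
def spencer (n m : ℕ) (E : LMod k A) :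
    Ω.FormMod m (Ω.J (n + 1) E) →ₗ[k] Ω.FormMod (m + 1) (Ω.J n E) :=
  Ω.spencer1 m (Ω.J n E) ∘ₗ (Ω.formMap m (Ω.l n E)).restrictScalars k

/-- The sesquiholonomic Spencer operator `S^{{n+1,m}}_E`, from `m`-forms with values in the
sesquiholonomic `(n+1)`-jets to `(m+1)`-forms with values in the sesquiholonomic `n`-jets. -/
def sSpencer (n m : ℕ) (E : LMod k A) :
    Ω.FormMod m (Ω.sJ (n + 1) E) →ₗ[k] Ω.FormMod (m + 1) (Ω.sJ n E) :=
  Ω.spencer1 m (Ω.sJ n E) ∘ₗ (Ω.formMap m (Ω.sl1 n E)).restrictScalars k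

/-- The operator `S̄^{{n+1,m}}_E`, from `m`-forms with values in the sesquiholonomic `(n+1)`-jets
to `(m+1)`-forms with values in the holonomic `n`-jets. -/
def spencerBar (n m : ℕ) (E : LMod k A) :
    Ω.FormMod m (Ω.sJ (n + 1) E) →ₗ[k] Ω.FormMod (m + 1) (Ω.J n E) :=
  Ω.spencer1 m (Ω.J n E) ∘ₗ (Ω.formMap m (Ω.sl n E)).restrictScalars k

/-- The unit `1 ∈ Ω⁰ = A`. -/
def oneForm : Ω.Form 0 := ⟨1, by simpa using Ω.incl_mem 1⟩

/-- The map `E → Ω⁰ ⊗_A E`, `e ↦ 1 ⊗ e`. -/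
def zeroFormMap (E : LMod k A) : E →ₗ[A] Ω.FormMod 0 E where
  toFun e := bt Ω.oneForm e
  map_add' x y := bt_add_right _ x y
  map_smul' r x := by
    rw [← bt_balanced, RingHom.id_apply, ← bt_smul_left]
    congr 1
    exact Form.ext (by rw [Form.val_rsmul, Form.val_lsmul]; simp [oneForm, Form.val])

theorem zeroFormMap_bijective (E : LMod k A) : Function.Bijective (Ω.zeroFormMap E) := by
  let e : A ≃ₗ[k] Ω.Form 0 := LinearEquiv.ofBijective
    ({ toFun := fun a => ⟨Ω.incl a, Ω.incl_mem a⟩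
       map_add' := fun a b => Form.ext (map_add Ω.incl a b)
       map_smul' := fun c a => Form.ext (map_smul Ω.incl c a) } : A →ₗ[k] Ω.Form 0)
    ⟨fun a b h => Ω.incl_injective (congrArg Form.val h), fun x => by
      have h := x.val_mem
      rw [← Ω.range_incl] at h
      obtain ⟨a, ha⟩ := h
      exact ⟨a, Form.ext ha⟩⟩
  have he (a : A) : (e a).val = Ω.incl a := rfl
  let G : Ω.FormMod 0 E →ₗ[k] E := BTensor.lift
    (LinearMap.mk₂ k (fun ω x => e.symm ω • x)
      (fun ω ω' x => by rw [map_add, add_smul])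
      (fun c ω x => by rw [map_smul, smul_assoc])
      (fun ω x y => smul_add _ x y)
      (fun c ω x => smul_comm _ c x))
    (fun ω a x => by
      simp only [LinearMap.mk₂_apply]
      obtain ⟨b, rfl⟩ := e.surjective ω
      have h : MulOpposite.op a • e b = e (b * a) := Form.ext (by
        rw [Form.val_rsmul, he, he, map_mul])
      rw [h, e.symm_apply_apply, e.symm_apply_apply, mul_smul])
  have h1 : Ω.oneForm = e 1 := Form.ext (by rw [he, map_one]; rfl)
  constructor
  · intro x y hxy
    have hG (z : E) : G (Ω.zeroFormMap E z) = z := by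
      change e.symm Ω.oneForm • z = z
      rw [h1, e.symm_apply_apply, one_smul]
    rw [← hG x, ← hG y, hxy]
  · intro x
    induction x using BTensor.induction with
    | tmul ω z =>
      obtain ⟨b, rfl⟩ := e.surjective ω
      refine ⟨b • z, ?_⟩
      change bt Ω.oneForm (b • z) = bt (e b) z
      rw [← bt_balanced]
      congr 1
      exact Form.ext (by rw [Form.val_rsmul, he]; simp [oneForm, Form.val])
    | add x y hx hy =>
      obtain ⟨x', rfl⟩ := hx
      obtain ⟨y', rfl⟩ := hy
      exact ⟨x' + y', map_add _ _ _⟩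

/-- The canonical identification `E ≅ Ω⁰ ⊗_A E`, `e ↦ 1 ⊗ e`. -/
noncomputable def zeroForm (E : LMod k A) : E ≃ₗ[A] Ω.FormMod 0 E :=
  LinearEquiv.ofBijective (Ω.zeroFormMap E) (Ω.zeroFormMap_bijective E)

/-- The operator `S̄^{{n+1,0}}_E`, on the sesquiholonomic `(n+1)`-jets, with `Ω⁰ ⊗_A -` removed. -/
noncomputable def spencerBar0 (n : ℕ) (E : LMod k A) :
    Ω.sJ (n + 1) E →ₗ[k] Ω.FormMod 1 (Ω.J n E) :=
  Ω.spencerBar n 0 E ∘ₗ (Ω.zeroForm (Ω.sJ (n + 1) E)).toLinearMap.restrictScalars k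

/-- The operator `S^{{n+1,0}}_E`, on the sesquiholonomic `(n+1)`-jets, with `Ω⁰ ⊗_A -` removed. -/
noncomputable def sSpencer0 (n : ℕ) (E : LMod k A) :
    Ω.sJ (n + 1) E →ₗ[k] Ω.FormMod 1 (Ω.sJ n E) :=
  Ω.sSpencer n 0 E ∘ₗ (Ω.zeroForm (Ω.sJ (n + 1) E)).toLinearMap.restrictScalars k

end ExteriorCalculus

end NCJet

/-! Everything comes from one computation with two first order Spencer operators. Applying `S^{1,0}`
to `[a ⊗ b] ⊗ ξ` gives `da ⊗ bξ`. If a left linear map `f` sends `ξ` to `[c ⊗ c'] ⊗ e`, then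
`S^{1,1}` turns `da ⊗ [bc ⊗ c'] ⊗ e` into `d(da · bc) c' ⊗ e`. Since `d² = 0` and `da` has degree
one, this is `-da ∧ d(bc) c' ⊗ e`, which is `-D̃ᴵᴵ` of the original element. This is
`spencer1_one_spencer1_zero`; taking for `f` the map `l` from holonomic jets to `J¹` of lower jets
gives the first claim.

A sesquiholonomic jet already satisfies `D̃ᴵ = 0`. By the first claim, killing the composite of
Spencer operators adds `D̃ᴵᴵ = 0`, and the two conditions together define the holonomic jets
(`ker_spencer_spencerBar0`).

For the last claim, naturality of the first order Spencer operator shows that the sesquiholonomic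
composite is the previous one followed by `Ω²(t)`, with `t` the inclusion of holonomic into
sesquiholonomic jets (`sSpencer_sSpencer0`). Its kernel can therefore only grow, and it stays the
same when `Ω²(t)` is injective, which flatness of `Ω²` ensures. -/

namespace NCJet

namespace ExteriorCalculus

variable {k : Type v} {A : Type u} [CommRing k] [Ring A] [Algebra k A] (Ω : ExteriorCalculus k A)

/-! ### Naturality of the Spencer operator, and functoriality of `Ωᵐ ⊗_A -` -/

/-- Naturality of the first order Spencer operator. -/
theorem spencer1_formMap_jet1Map (m : ℕ) {E E' : LMod k A} (f : E →ₗ[A] E')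
    (x : Ω.FormMod m (Ω.Jet1 E)) :
    Ω.spencer1 m E' (Ω.formMap m (Ω.jet1Map f) x) = Ω.formMap (m + 1) f (Ω.spencer1 m E x) := by
  induction x using BTensor.induction with
  | tmul ω y =>
    induction y using BTensor.induction with
    | tmul p e => rfl
    | add s t hs ht => simp only [bt_add_right, map_add, hs, ht]
  | add s t hs ht => simp only [map_add, hs, ht]

theorem formMap_comp_apply (m : ℕ) {E E' E'' : LMod k A} (g : E' →ₗ[A] E'') (f : E →ₗ[A] E')
    (x : Ω.FormMod m E) : Ω.formMap m (g ∘ₗ f) x = Ω.formMap m g (Ω.formMap m f x) := by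
  induction x using BTensor.induction with
  | tmul ω e => rfl
  | add s t hs ht => simp only [map_add, hs, ht]

/-! ### The composite of two first order Spencer operators -/

/-- In degree zero the operator is `d(1 · a) b ⊗ e`. Keeping `b` on the module side lets a left
linear map act next, as `f (b • e) = b • f e`. -/
theorem spencer1_zero_bt (E : LMod k A) (a b : A) (e : E) :
    Ω.spencer1 0 E (Ω.zeroFormMap (Ω.Jet1 E) (bt (Ω.jc a b) e)) = bt (Ω.dA a) (b • e) := by
  rw [← bt_balanced]
  change Ω.spencer1 0 E (bt Ω.oneForm (bt (Ω.jc a b) e)) = _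
  rw [spencer1_bt]
  congr 1
  apply Form.ext
  change Ω.d (1 * Ω.incl a) * Ω.incl b = Ω.d (Ω.incl a) * Ω.incl b
  rw [one_mul]

/-- Composing two first order Spencer operators gives `-D̃ᴵᴵ`; here the inner jet is allowed to come
from a module `F` through a linear map `f`. -/
theorem spencer1_one_spencer1_zero {E F : LMod k A} (f : F →ₗ[A] Ω.Jet1 E) (x : Ω.Jet1 F) :
    Ω.spencer1 1 E (Ω.formMap 1 f (Ω.spencer1 0 F (Ω.zeroFormMap (Ω.Jet1 F) x))) =
      -Ω.tildeDII E (Ω.jet1Map f x) := by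
  induction x using BTensor.induction with
  | tmul p ξ =>
    induction p using Jet1A.induction with
    | tmul a b =>
      rw [spencer1_zero_bt]
      change Ω.spencer1 1 E (bt (Ω.dA a) (f (b • ξ))) = -Ω.tildeDII E (bt (Ω.jc a b) (f ξ))
      -- Left linearity of `f` makes `ξ` enter only through `f ξ`. This is a general element of
      -- `J¹E`, so it is replaced by a variable and decomposed into elementary tensors.
      rw [map_smul]
      generalize f ξ = y
      induction y using BTensor.induction with
      | tmul q e =>
        induction q using Jet1A.induction with
        | tmul c c' =>
          -- The sign is removed by moving everything to one side; additivity of `bt` in its first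
          -- slot then leaves an identity between 2-forms.
          rw [← bt_smul_left, smul_jc, spencer1_bt, tildeDII_bt, eq_neg_iff_add_eq_zero]
          refine (bt_add_left (k := k) (A := A) (M := Ω.Form 2) _ _ e).symm.trans ?_
          rw [show MulOpposite.op c' • Ω.dForm 1 (MulOpposite.op (b * c) • Ω.dA a) +
              Ω.wedge 1 1 (Ω.dA a) (MulOpposite.op c' • Ω.dA (b * c)) = (0 : Ω.Form 2) from ?_]
          -- `0 ⊗ e = 0`, read off from homogeneity with scalar `0 : k`.
          · simpa using bt_ksmul_left (A := A) (0 : k) (0 : Ω.Form 2) e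
          · apply Form.ext
            change Ω.d (Ω.d (Ω.incl a) * Ω.incl (b * c)) * Ω.incl c' +
              Ω.d (Ω.incl a) * (Ω.d (Ω.incl (b * c)) * Ω.incl c') = 0
            -- Graded Leibniz rule with `da` of degree 1: the term `d(da)` vanishes, and the sign
            -- `(-1) ^ 1` on the other makes the two summands cancel.
            rw [Ω.d_mul 1 (Ω.d (Ω.incl a)) _ (Ω.dA a).val_mem, Ω.d_d]
            noncomm_ring
        | add s t hs ht =>
          simp only [bt_add_left, bt_add_right, smul_add, map_add, hs, ht]; abel
      | add s t hs ht =>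
        simp only [bt_add_right, smul_add, map_add, hs, ht]; abel
    | add s t hs ht => simp only [bt_add_left, map_add, hs, ht]; abel
  | add s t hs ht => simp only [map_add, hs, ht]; abel

/-! ### Spencer operators on holonomic and sesquiholonomic jets -/

/-- The identification `M ≅ Ω⁰ ⊗_A M` is natural in `M`, because `Ω⁰(f)` sends `1 ⊗ x` to `1 ⊗ f x`
by definition. -/
theorem spencerBar0_apply (n : ℕ) (E : LMod k A) (x : Ω.sJ (n + 1) E) :
    Ω.spencerBar0 n E x =
      Ω.spencer1 0 (Ω.J n E) (Ω.zeroFormMap (Ω.Jet1 (Ω.J n E)) (Ω.sl n E x)) := rfl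

theorem spencer_spencerBar0 (n : ℕ) (E : LMod k A) (x : Ω.sJ (n + 2) E) :
    Ω.spencer n 1 E (Ω.spencerBar0 (n + 1) E x) =
      -Ω.tildeDII (Ω.J n E) (Ω.jet1Map (Ω.l n E) (Ω.sl (n + 1) E x)) := by
  rw [spencerBar0_apply]
  exact Ω.spencer1_one_spencer1_zero (Ω.l n E) (Ω.sl (n + 1) E x)

/-- For positive `n` all three maps are inclusions between submodules of `J¹JⁿE`; for `n = 0` they
are identities. -/
theorem sl_t (n : ℕ) (E : LMod k A) : Ω.sl n E ∘ₗ Ω.t (n + 1) E = Ω.l n E := by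
  cases n <;> rfl

theorem t_injective (n : ℕ) (E : LMod k A) : Function.Injective (Ω.t n E) := by
  match n with
  | 0 => exact Function.injective_id
  | 1 => exact Function.injective_id
  | n + 2 => exact Submodule.inclusion_injective (fun _ hx => congrArg Prod.fst hx)

/-- Since `sl1` is `sl` followed by `J¹(t)`, naturality in degree zero pulls `t` out of the Spencer
operator. -/
theorem sSpencer0_eq (n : ℕ) (E : LMod k A) (x : Ω.sJ (n + 1) E) :
    Ω.sSpencer0 n E x = Ω.formMap 1 (Ω.t n E) (Ω.spencerBar0 n E x) :=
  Ω.spencer1_formMap_jet1Map 0 (Ω.t n E) (Ω.zeroFormMap (Ω.Jet1 (Ω.J n E)) (Ω.sl n E x))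

/-- The holonomic and sesquiholonomic Spencer operators are intertwined by the inclusions. -/
theorem sSpencer_formMap_t (n m : ℕ) (E : LMod k A) (x : Ω.FormMod m (Ω.J (n + 1) E)) :
    Ω.sSpencer n m E (Ω.formMap m (Ω.t (n + 1) E) x) =
      Ω.formMap (m + 1) (Ω.t n E) (Ω.spencer n m E x) := by
  change Ω.spencer1 m (Ω.sJ n E)
    (Ω.formMap m (Ω.sl1 n E) (Ω.formMap m (Ω.t (n + 1) E) x)) = _
  -- By `sl_t`, `sl1` after `t` is `J¹(t) ∘ l`; naturality then carries `t` past the Spencer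
  -- operator.
  rw [← formMap_comp_apply, sl1, LinearMap.comp_assoc, sl_t, formMap_comp_apply,
    spencer1_formMap_jet1Map]
  rfl

/-- The factorization that reduces the third claim to the second: only the kernel of `Ω²(t)` can
separate the two composites. The inclusion is moved outwards past each Spencer operator in turn. -/
theorem sSpencer_sSpencer0 (n : ℕ) (E : LMod k A) (x : Ω.sJ (n + 2) E) :
    Ω.sSpencer n 1 E (Ω.sSpencer0 (n + 1) E x) =
      Ω.formMap 2 (Ω.t n E) (Ω.spencer n 1 E (Ω.spencerBar0 (n + 1) E x)) := by
  rw [sSpencer0_eq]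
  exact Ω.sSpencer_formMap_t n 1 E _

theorem ker_spencer_spencerBar0 (n : ℕ) (E : LMod k A) :
    LinearMap.ker (Ω.spencer n 1 E ∘ₗ Ω.spencerBar0 (n + 1) E) =
      (LinearMap.range (Ω.t (n + 2) E)).restrictScalars k := by
  ext x
  change Ω.spencer n 1 E (Ω.spencerBar0 (n + 1) E x) = 0 ↔ ∃ y, Ω.t (n + 2) E y = x
  rw [spencer_spencerBar0, neg_eq_zero]
  constructor
  · intro h
    -- `x.2` is the vanishing of `D̃ᴵ` and `h` that of `D̃ᴵᴵ`; as a pair they say that `D̃`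
    -- vanishes, so the same element of `J¹J^{n+1}E` is holonomic.
    exact ⟨⟨x.1, Prod.ext x.2 h⟩, rfl⟩
  · rintro ⟨y, rfl⟩
    exact congrArg Prod.snd y.2

end ExteriorCalculus

end NCJet

/-! ### The three claims -/

/-- The jet order `≥ 2` is written `n + 2`, and the first index of each Spencer operator is one less
than its order, so `spencer n 1` is `S^{n+1,1}`. Spencer operators are only `k`-linear, hence
kernels are `k`-submodules and the image of `t` is restricted to `k` for comparison. -/
theorem lemma3p21 {k : Type v} {A : Type u} [CommRing k] [Ring A] [Algebra k A]
    (Ω : NCJet.ExteriorCalculus k A) (E : NCJet.LMod k A) (n : ℕ) :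
    (Ω.spencer n 1 E ∘ₗ Ω.spencerBar0 (n + 1) E =
      -(Ω.tildeDII (Ω.J n E) ∘ₗ (Ω.jet1Map (Ω.l n E)).restrictScalars k ∘ₗ
        (Ω.sl (n + 1) E).restrictScalars k)) ∧
    LinearMap.ker (Ω.spencer n 1 E ∘ₗ Ω.spencerBar0 (n + 1) E) =
      (LinearMap.range (Ω.t (n + 2) E)).restrictScalars k ∧
    (LinearMap.range (Ω.t (n + 2) E)).restrictScalars k ≤
      LinearMap.ker (Ω.sSpencer n 1 E ∘ₗ Ω.sSpencer0 (n + 1) E) ∧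
    (NCJet.IsRightFlat k A (Ω.Form 2) →
      LinearMap.ker (Ω.sSpencer n 1 E ∘ₗ Ω.sSpencer0 (n + 1) E) =
        (LinearMap.range (Ω.t (n + 2) E)).restrictScalars k) := by
  refine ⟨LinearMap.ext fun x => Ω.spencer_spencerBar0 n E x, Ω.ker_spencer_spencerBar0 n E, ?_, ?_⟩
  · rw [← Ω.ker_spencer_spencerBar0 n E]
    intro x hx
    have hx' : Ω.spencer n 1 E (Ω.spencerBar0 (n + 1) E x) = 0 := hx
    change Ω.sSpencer n 1 E (Ω.sSpencer0 (n + 1) E x) = 0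
    -- No flatness is needed here: `Ω²(t)` sends zero to zero.
    rw [Ω.sSpencer_sSpencer0, hx', map_zero]
  · intro hflat
    rw [← Ω.ker_spencer_spencerBar0 n E]
    ext x
    change Ω.sSpencer n 1 E (Ω.sSpencer0 (n + 1) E x) = 0 ↔
      Ω.spencer n 1 E (Ω.spencerBar0 (n + 1) E x) = 0
    rw [Ω.sSpencer_sSpencer0]
    -- Flatness is applied to the single inclusion `t : JⁿE → sJ n E`, so that `Ω²(t)` reflects
    -- zero.
    exact map_eq_zero_iff _ (hflat _ _ _ (Ω.t_injective n E))
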